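/- Let $\mathbb{X}$ be a metric space, $k>0$ a real number, $\mathcal{H}^k$ the $k$-dimensional Hausdorff measure and $B(x,r)$ the open ball. For $C>1$, a set $E\subseteq\mathbb{X}$ is called $k$-Ahlfors-David regular ($k$-ADR) with constant $C$ if it is closed, has more than one point, and for all $x\in E$ $$C^{-1}r^k<\mathcal{H}^k(E\cap B(x,r))\ \text{ for all } r\in(0,\operatorname{diam}E),\qquad \mathcal{H}^k(E\cap B(x,r))<Cr^k\ \text{ for all } r>0 ,$$ where $\operatorname{diam}E\in(0,\infty]$. For a class $\mathcal{F}$ of subsets of $\mathbb{X}$, $C>1$ and $\theta>0$, let $\mathrm{BP}_{C,\theta}(\mathcal{F})$ be the class of all sets $F\subseteq\mathbb{X}$ that are $k$-ADR with constant $C$ and such that for every $x\in F$ and every $R>0$ there is $G\in\mathcal{F}$ with $$\mathcal{H}^k(B(x,R)\cap F\cap G)\ \ge\ \theta\,\mathcal{H}^k(B(x,R)\cap F).$$ **Theorem.** For all $k>0$, $C_1,C_2>1$ and $\theta_1,\theta_2>0$ there are $C>1$ and $\theta>0$, depending only on $k,C_1,\theta_1,C_2,\theta_2$, such that the following holds.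 Let $\mathbb{X}$ be a metric space and $\mathcal{F}$ a class of subsets of $\mathbb{X}$, each of which is $k$-ADR (with some constant, which may depend on the set). If $E\in \mathrm{BP}_{C_1,\theta_1}\big(\mathrm{BP}_{C_2,\theta_2}(\mathcal{F})\big)$ (with $\operatorname{diam}E$ finite or infinite), then there is a set $F\subseteq\mathbb{X}$ such that (i) $E\subseteq F$; (ii) $F$ is $k$-ADR with constant $C$; (iii) $F\in\mathrm{BP}_{C,\theta}(\mathcal{F})$. -/

import Mathlib

open MeasureTheory

/-- `IsADRegular k C E`: the set `E` is `k`-Ahlfors-David regular with constant `C`.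
It is closed, has more than one point, the lower mass bound holds at all radii below the
(possibly infinite) diameter of `E`, and the upper mass bound holds at all radii. -/
def IsADRegular {X : Type*} [MetricSpace X] [MeasurableSpace X] [BorelSpace X]
    (k C : ℝ) (E : Set X) : Prop :=
  IsClosed E ∧ E.Nontrivial ∧
  (∀ x ∈ E, ∀ r : ℝ, 0 < r → ENNReal.ofReal r < Metric.ediam E →
    ENNReal.ofReal (C⁻¹ * r ^ k) < Measure.hausdorffMeasure k (E ∩ Metric.ball x r)) ∧
  (∀ x ∈ E, ∀ r : ℝ, 0 < r →
    Measure.hausdorffMeasure k (E ∩ Metric.ball x r) < ENNReal.ofReal (C * r ^ k))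

/-- `BP k C θ 𝓕`: the class of sets that are `k`-Ahlfors-David regular with constant `C`
and have big pieces of members of `𝓕` with constant `θ`. -/
def BP {X : Type*} [MetricSpace X] [MeasurableSpace X] [BorelSpace X]
    (k C θ : ℝ) (𝓕 : Set (Set X)) : Set (Set X) :=
  {F | IsADRegular k C F ∧ ∀ x ∈ F, ∀ R : ℝ, 0 < R → ∃ G ∈ 𝓕,
    ENNReal.ofReal θ * Measure.hausdorffMeasure k (Metric.ball x R ∩ F) ≤
      Measure.hausdorffMeasure k (Metric.ball x R ∩ F ∩ G)}

/-! `F` is `E` together with separated pieces of the sets of `BP k C₂ θ₂ 𝓕` that have big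
intersection with `E`, chosen so that every ball centred on `F` contains a comparable ball of one
such `G`, lying wholly in `F`. That ball gives the lower mass bound and, through the big pieces of
`G` itself, the big pieces of `F`.

The trace of `G` on a ball may be thin near its boundary, so `exists_corkscrew_subset` enlarges it
to a piece `P` with interior balls at all scales. Fix `x₀ ∈ E` and allow pieces at `y ∈ E` of size
at most `dist y x₀ / 10`. A Vitali selection (`exists_conflictFree_subfamily`) keeps a separated
subfamily which still has pieces of comparable size near each admissible ball.

For the upper bound in a ball of radius `s`, separation allows only one piece of size at least `2 *
s`. The smaller pieces are disjoint, and each has mass comparable to its share of `E`, so their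
masses sum to at most a constant times `s ^ k`. -/

open Metric Set

/-! ### Interior balls, Vitali selection and small powers -/

/-- A closed set `G` has, inside `closedBall y (2 * r)`, a closed subset containing `G ∩ ball y r`
which around each of its points contains full balls of `G` at every scale up to `r`. -/
theorem exists_corkscrew_subset {X : Type*} [MetricSpace X] {G : Set X} (hG : IsClosed G)
    (y : X) {r : ℝ} (hr : 0 < r) :
    ∃ P : Set X, IsClosed P ∧ P ⊆ G ∧ G ∩ ball y r ⊆ P ∧ P ⊆ closedBall y (2 * r) ∧
      ∀ z ∈ P, ∀ s, 0 < s → s ≤ r → ∃ w ∈ G, G ∩ ball w (s / 8) ⊆ P ∩ ball z s := by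
  -- The collar widths r/4, r/8, ... sum to r/2, which keeps every stage inside the ball of radius
  -- `2 * r`.
  let U : ℕ → Set X := fun n => Nat.rec (G ∩ ball y r)
    (fun n V => G ∩ thickening (r * (1 / 2) ^ (n + 2)) V) n
  have hU0 : U 0 = G ∩ ball y r := rfl
  have hUs : ∀ n, U (n + 1) = G ∩ thickening (r * (1 / 2) ^ (n + 2)) (U n) := fun n => rfl
  have hUG : ∀ n, U n ⊆ G := by
    intro n
    cases n with
    | zero => exact inter_subset_left
    | succ n => rw [hUs]; exact inter_subset_left
  have hmono : Monotone U := monotone_nat_of_le_succ fun n x hx => by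
    rw [hUs]
    exact ⟨hUG n hx, self_subset_thickening (by positivity) _ hx⟩
  have back : ∀ i n, ∀ z ∈ U (i + n), ∃ w ∈ U i,
      dist z w ≤ r * (1 / 2) ^ (i + 1) * (1 - (1 / 2) ^ n) := by
    intro i n
    induction n with
    | zero => intro z hz; exact ⟨z, hz, by simp⟩
    | succ n ih =>
      intro z hz
      rw [← add_assoc, hUs] at hz
      obtain ⟨v, hv, hzv⟩ := mem_thickening_iff.1 hz.2
      obtain ⟨w, hw, hvw⟩ := ih v hv
      refine ⟨w, hw, (dist_triangle z v w).trans ?_⟩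
      have e : r * (1 / 2) ^ (i + n + 2) + r * (1 / 2) ^ (i + 1) * (1 - (1 / 2) ^ n)
          = r * (1 / 2 : ℝ) ^ (i + 1) * (1 - (1 / 2) ^ (n + 1)) := by
        ring
      linarith
  have back' : ∀ i n, ∀ z ∈ U n, ∃ w ∈ U i, dist z w ≤ r * (1 / 2) ^ (i + 1) := by
    intro i n z hz
    rcases le_total n i with h | h
    · exact ⟨z, hmono h hz, by rw [dist_self]; positivity⟩
    · obtain ⟨m, rfl⟩ := Nat.exists_eq_add_of_le h
      obtain ⟨w, hw, hzw⟩ := back i m z hz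
      refine ⟨w, hw, hzw.trans (mul_le_of_le_one_right (by positivity) ?_)⟩
      have : (0 : ℝ) ≤ (1 / 2) ^ m := by positivity
      linarith
  refine ⟨closure (⋃ n, U n), isClosed_closure,
    closure_minimal (iUnion_subset hUG) hG,
    fun z hz => subset_closure (mem_iUnion.2 ⟨0, hz⟩), ?_, ?_⟩
  · refine closure_minimal (iUnion_subset fun n z hz => ?_) isClosed_closedBall
    obtain ⟨w, hw, hzw⟩ := back' 0 n z hz
    have h1 : dist w y < r := hw.2
    have h2 := dist_triangle z w y
    rw [mem_closedBall]
    norm_num at hzw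
    linarith
  · intro z hz s hs hsr
    -- At this dyadic scale, retreating to stage `n + 1` costs less than `s / 2`, and the next
    -- collar has width at least `s / 8`.
    obtain ⟨n, hn1, hn2⟩ := exists_nat_pow_near_of_lt_one (x := s / r) (y := (1 / 2 : ℝ))
      (by positivity) ((div_le_one hr).2 hsr) (by norm_num) (by norm_num)
    rw [lt_div_iff₀ hr] at hn1
    rw [div_le_iff₀ hr] at hn2
    obtain ⟨v, hv, hzv⟩ := Metric.mem_closure_iff.1 hz (s / 8) (by positivity)
    obtain ⟨m, hm⟩ := mem_iUnion.1 hv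
    obtain ⟨w, hw, hvw⟩ := back' (n + 1) m v hm
    refine ⟨w, hUG (n + 1) hw, ?_⟩
    rintro x ⟨hxG, hxw⟩
    rw [mem_ball] at hxw
    have e1 : r * (1 / 2 : ℝ) ^ (n + 1 + 1) = ((1 / 2) ^ (n + 1) * r) / 2 := by ring
    have e2 : r * (1 / 2 : ℝ) ^ (n + 1 + 2) = ((1 / 2) ^ n * r) / 8 := by ring
    refine ⟨subset_closure (mem_iUnion.2 ⟨n + 1 + 1, ?_⟩), ?_⟩
    · rw [hUs]
      refine ⟨hxG, mem_thickening_iff.2 ⟨w, hw, ?_⟩⟩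
      rw [e2]
      linarith
    · rw [e1] at hvw
      have h1 := dist_triangle x w z
      have h2 := dist_triangle w v z
      rw [dist_comm w v, dist_comm v z] at h2
      rw [mem_ball]
      linarith

/-- From a family of indices with bounded sizes one can select a subfamily without conflicts such
that each index conflicts with a selected one of at least half its size. -/
theorem exists_conflictFree_subfamily {ι : Type*} (t : Set ι) (conf : ι → ι → Prop)
    (hsymm : ∀ a b, conf a b → conf b a) (hrefl : ∀ a ∈ t, conf a a)
    (δ : ι → ℝ) (R : ℝ) (hδ : ∀ a ∈ t, 0 ≤ δ a) (hR : ∀ a ∈ t, δ a ≤ R) :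
    ∃ u ⊆ t, (∀ a ∈ u, ∀ b ∈ u, a ≠ b → ¬ conf a b) ∧
      ∀ a ∈ t, ∃ b ∈ u, conf a b ∧ δ a ≤ 2 * δ b := by
  -- Each index is replaced by its star in the conflict graph: the stars of two distinct indices
  -- share an edge exactly when the indices conflict.
  obtain ⟨u, hut, hdisj, hcov⟩ := Vitali.exists_disjoint_subfamily_covering_enlargement
    (fun a => {e : Sym2 ι | ∃ b, conf a b ∧ e = s(a, b)}) t δ 2 one_lt_two hδ R hR
    (fun a ha => ⟨s(a, a), a, hrefl a ha, rfl⟩)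
  refine ⟨u, hut, fun a ha b hb hab h => ?_, fun a ha => ?_⟩
  · exact Set.disjoint_left.1 (hdisj ha hb hab) ⟨b, h, rfl⟩ ⟨a, hsymm a b h, Sym2.eq_swap⟩
  · obtain ⟨b, hb, ⟨e, ⟨c, hac, rfl⟩, d, hbd, hcd⟩, hle⟩ := hcov a ha
    refine ⟨b, hb, ?_, hle⟩
    rcases Sym2.eq_iff.1 hcd with ⟨h, -⟩ | ⟨-, h⟩
    · subst h; exact hrefl a ha
    · subst h; exact hac

/-- Positive numbers with arbitrarily small `k`-th power. -/
theorem exists_pos_rpow_le {k A : ℝ} (hk : 0 < k) (hA : 0 < A) :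
    ∃ ε : ℝ, 0 < ε ∧ ε ≤ 1 / 8 ∧ ε ^ k ≤ A := by
  refine ⟨min (1 / 8) (A ^ (1 / k)), by positivity, min_le_left _ _, ?_⟩
  calc (min (1 / 8) (A ^ (1 / k))) ^ k ≤ (A ^ (1 / k)) ^ k :=
        Real.rpow_le_rpow (by positivity) (min_le_right _ _) hk.le
    _ = A := by rw [← Real.rpow_mul hA.le, one_div_mul_cancel hk.ne', Real.rpow_one]

/-! ### Mass and diameter of regular sets -/

section Pieces

variable {X : Type*} [MetricSpace X] [MeasurableSpace X] [BorelSpace X]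

/-- The upper mass bound for balls with arbitrary centre. -/
theorem IsADRegular.measure_inter_ball_le {k C : ℝ} {E : Set X} (hE : IsADRegular k C E)
    (z : X) {s : ℝ} (hs : 0 < s) :
    μH[k] (E ∩ ball z s) ≤ ENNReal.ofReal (C * (2 * s) ^ k) := by
  rcases (E ∩ ball z s).eq_empty_or_nonempty with h | ⟨w, hw, hwz⟩
  · simp [h]
  · refine (measure_mono ?_).trans (hE.2.2.2 w hw (2 * s) (by positivity)).le
    refine inter_subset_inter_right _ fun x hx => ?_
    rw [mem_ball] at *
    have := dist_triangle x z w
    rw [dist_comm z w] at this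
    linarith

/-- A set which carries a mass comparable to `r ^ k` has diameter at least comparable to `r`. -/
theorem IsADRegular.lt_ediam {k C c ε r : ℝ} {G : Set X} (hG : IsADRegular k C G)
    (hC : 0 < C) (hε : 0 < ε) (hεk : ε ^ k ≤ c / (C * 2 ^ k)) (hr : 0 < r)
    (hm : ENNReal.ofReal (c * r ^ k) ≤ μH[k] G) : ENNReal.ofReal (ε * r) < ediam G := by
  by_contra! h
  obtain ⟨w, hw⟩ := hG.2.1.nonempty
  have hsub : G ⊆ G ∩ ball w (2 * (ε * r)) := fun x hx => ⟨hx, by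
    have h1 := (edist_le_ediam_of_mem hx hw).trans h
    rw [edist_dist, ENNReal.ofReal_le_ofReal_iff (by positivity)] at h1
    rw [mem_ball]
    have : 0 < ε * r := by positivity
    linarith⟩
  have h2 := (hm.trans (measure_mono hsub)).trans_lt (hG.2.2.2 w hw _ (by positivity))
  rw [ENNReal.ofReal_lt_ofReal_iff'] at h2
  have h3 : C * (2 * (ε * r)) ^ k = C * 2 ^ k * ε ^ k * r ^ k := by
    rw [Real.mul_rpow (by norm_num) (by positivity), Real.mul_rpow hε.le hr.le]; ring
  rw [le_div_iff₀ (by positivity)] at hεk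
  have h4 : ε ^ k * (C * 2 ^ k) * r ^ k ≤ c * r ^ k := by gcongr
  have h5 := h2.1
  rw [h3] at h5
  linarith

/-- In a regular set each ball contains a point at a definite distance from a given one. -/
theorem IsADRegular.exists_far_point {k C ε R : ℝ} {E : Set X} (hE : IsADRegular k C E)
    (hC : 0 < C) (hε : 0 < ε) (hεk : ε ^ k ≤ (1 / 8) ^ k / C ^ 2) {x x₀ : X}
    (hx : x ∈ E) (hx₀ : x₀ ∈ E) (hR : 0 < R) (hRE : ENNReal.ofReal (R / 8) < ediam E) :
    ∃ y ∈ E, dist y x < R / 8 ∧ ε * R ≤ dist y x₀ := by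
  by_contra! h
  have h1 := hE.2.2.1 x hx (R / 8) (by positivity) hRE
  have h2 : E ∩ ball x (R / 8) ⊆ E ∩ ball x₀ (ε * R) := fun y hy => ⟨hy.1, h y hy.1 hy.2⟩
  have h3 := (h1.trans_le (measure_mono h2)).trans (hE.2.2.2 x₀ hx₀ _ (by positivity))
  have h4 := (ENNReal.ofReal_lt_ofReal_iff'.1 h3).1
  rw [Real.mul_rpow hε.le hR.le, show R / 8 = 1 / 8 * R by ring,
    Real.mul_rpow (by norm_num) hR.le] at h4
  have h5 : C * (ε ^ k * R ^ k) ≤ C * ((1 / 8) ^ k / C ^ 2 * R ^ k) := by gcongr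
  have h6 : C * ((1 / 8) ^ k / C ^ 2 * R ^ k) = C⁻¹ * ((1 / 8) ^ k * R ^ k) := by
    field_simp
  linarith

/-! ### Pieces and their selection -/

/-- `P` is a closed part of `G` of size `r` near the point `y` of `E`, which contains full balls of
`G` at every scale up to `r` and carries a mass at least `c * r ^ k` of `E`. -/
structure IsPiece (k c : ℝ) (E G P : Set X) (y : X) (r : ℝ) : Prop where
  mem : y ∈ E
  pos : 0 < r
  closed : IsClosed P
  subset : P ⊆ G
  subset_closedBall : P ⊆ closedBall y (2 * r)
  corkscrew : ∀ z ∈ P, ∀ s, 0 < s → s ≤ r → ∃ w ∈ G, G ∩ ball w (s / 8) ⊆ P ∩ ball z s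
  mass : ENNReal.ofReal (c * r ^ k) ≤ μH[k] (E ∩ P)

theorem IsPiece.nonempty {k c : ℝ} {E G P : Set X} {y : X} {r : ℝ} (h : IsPiece k c E G P y r)
    (hc : 0 < c) : P.Nonempty := by
  by_contra! hP
  have := h.mass
  have hr := h.pos
  rw [hP] at this
  simp only [inter_empty, measure_empty, nonpos_iff_eq_zero, ENNReal.ofReal_eq_zero] at this
  have : 0 < c * r ^ k := by positivity
  linarith

theorem IsPiece.exists_ball_subset {k c C ε : ℝ} {E G P : Set X} {y : X} {r : ℝ}
    (h : IsPiece k c E G P y r) (hG : IsADRegular k C G) (hC : 0 < C) (hε : 0 < ε)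
    (hε8 : ε ≤ 1 / 8) (hεk : ε ^ k ≤ c / (C * 2 ^ k)) {z : X} (hz : z ∈ P) {s : ℝ} (hs : 0 < s)
    (hsr : s ≤ r) :
    ∃ w ∈ G, G ∩ ball w (ε * s) ⊆ P ∩ ball z s ∧ ENNReal.ofReal (ε * s) < ediam G := by
  obtain ⟨w, hw, hwP⟩ := h.corkscrew z hz s hs hsr
  refine ⟨w, hw, (inter_subset_inter_right _ (ball_subset_ball ?_)).trans hwP, ?_⟩
  · nlinarith
  · refine lt_of_le_of_lt ?_ (hG.lt_ediam hC hε hεk h.pos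
      (h.mass.trans (measure_mono (inter_subset_right.trans h.subset))))
    gcongr

/-- A family of pieces of members of `𝓖` near `E`, separated from each other, among which each
ball centred on `E` which is small compared to the distance to `x₀` finds a piece of at least
comparable size. -/
structure IsPieceFamily (k c : ℝ) (E : Set X) (𝓖 : Set (Set X)) (x₀ : X) {ι : Type*} (u : Set ι)
    (G P : ι → Set X) (y : ι → X) (r : ι → ℝ) : Prop where
  piece : ∀ a ∈ u, IsPiece k c E (G a) (P a) (y a) (r a)
  mem : ∀ a ∈ u, G a ∈ 𝓖
  le_dist : ∀ a ∈ u, r a ≤ dist (y a) x₀ / 10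
  separated : ∀ a ∈ u, ∀ b ∈ u, a ≠ b → ∀ p ∈ P a, ∀ q ∈ P b, min (r a) (r b) ≤ dist p q
  cover : ∀ x ∈ E, ∀ s, 0 < s → s ≤ dist x x₀ / 10 →
    ∃ a ∈ u, s ≤ 4 * r a ∧ ∃ q ∈ P a, dist q x ≤ 3 * s

theorem exists_isPieceFamily {k C θ : ℝ} (hC : 0 < C) (hθ : 0 < θ) {E : Set X}
    (hE : IsADRegular k C E) {𝓖 : Set (Set X)} (h𝓖 : ∀ G ∈ 𝓖, IsClosed G)
    (hbig : ∀ x ∈ E, ∀ R : ℝ, 0 < R → ∃ G ∈ 𝓖,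
      ENNReal.ofReal θ * μH[k] (ball x R ∩ E) ≤ μH[k] (ball x R ∩ E ∩ G))
    {x₀ : X} (hx₀ : x₀ ∈ E) :
    ∃ (u : Set (X × ℝ)) (G P : X × ℝ → Set X),
      IsPieceFamily k (θ * C⁻¹) E 𝓖 x₀ u G P Prod.fst Prod.snd := by
  set t : Set (X × ℝ) := {a | a.1 ∈ E ∧ 0 < a.2 ∧ a.2 ≤ dist a.1 x₀ / 10} with ht
  have key : ∀ a : X × ℝ, ∃ G P : Set X, a ∈ t →
      G ∈ 𝓖 ∧ IsPiece k (θ * C⁻¹) E G P a.1 a.2 := by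
    intro a
    by_cases ha : a ∈ t
    · obtain ⟨haE, ha0, hax⟩ := ha
      obtain ⟨G, hG, hGm⟩ := hbig a.1 haE a.2 ha0
      obtain ⟨P, hPc, hPG, hsub, hPb, hcork⟩ := exists_corkscrew_subset (h𝓖 G hG) a.1 ha0
      refine ⟨G, P, fun _ => ⟨hG, haE, ha0, hPc, hPG, hPb, hcork, ?_⟩⟩
      have hd : ENNReal.ofReal a.2 < ediam E := by
        refine lt_of_lt_of_le ?_ (edist_le_ediam_of_mem haE hx₀)
        rw [edist_dist, ENNReal.ofReal_lt_ofReal_iff']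
        constructor <;> linarith
      calc ENNReal.ofReal (θ * C⁻¹ * a.2 ^ k)
          = ENNReal.ofReal θ * ENNReal.ofReal (C⁻¹ * a.2 ^ k) := by
            rw [← ENNReal.ofReal_mul hθ.le, mul_assoc]
        _ ≤ ENNReal.ofReal θ * μH[k] (ball a.1 a.2 ∩ E) := by
            rw [inter_comm]
            gcongr
            exact (hE.2.2.1 a.1 haE a.2 ha0 hd).le
        _ ≤ _ := hGm
        _ ≤ μH[k] (E ∩ P) := by
            refine measure_mono ?_
            rintro x ⟨⟨h1, h2⟩, h3⟩
            exact ⟨h2, hsub ⟨h3, h1⟩⟩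
    · exact ⟨∅, ∅, fun h => absurd h ha⟩
  choose G P hGP using key
  have hne : ∀ a ∈ t, (P a).Nonempty := fun a ha => (hGP a ha).2.nonempty (by positivity)
  obtain ⟨u, hut, hsep, hcov⟩ := exists_conflictFree_subfamily t
    (fun a b => ∃ p ∈ P a, ∃ q ∈ P b, dist p q < min a.2 b.2)
    (fun a b ⟨p, hp, q, hq, h⟩ => ⟨q, hq, p, hp, by rwa [dist_comm, min_comm]⟩)
    (fun a ha => by
      obtain ⟨p, hp⟩ := hne a ha
      exact ⟨p, hp, p, hp, by simpa using ha.2.1⟩)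
    -- The relative size is bounded even when `E` is unbounded. Conflicting pieces lie at comparable
    -- distances from `x₀`, so relative and actual sizes compare up to a constant.
    (fun a => a.2 / dist a.1 x₀) (1 / 10)
    (fun a ha => div_nonneg ha.2.1.le dist_nonneg)
    (fun a ha => by
      have h1 := ha.2.1
      have h2 := ha.2.2
      rw [div_le_iff₀ (by linarith)]
      linarith)
  refine ⟨u, G, P, fun a ha => (hGP a (hut ha)).2, fun a ha => (hGP a (hut ha)).1,
    fun a ha => (hut ha).2.2, fun a ha b hb hab p hp q hq => ?_, fun x hx s hs hsx => ?_⟩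
  · by_contra! h
    exact hsep a ha b hb hab ⟨p, hp, q, hq, h⟩
  · obtain ⟨b, hb, ⟨p, hp, q, hq, hpq⟩, hle⟩ := hcov (x, s) ⟨hx, hs, hsx⟩
    have hpx : dist p x ≤ 2 * s := (hGP (x, s) ⟨hx, hs, hsx⟩).2.subset_closedBall hp
    have hqb : dist q b.1 ≤ 2 * b.2 := (hGP b (hut hb)).2.subset_closedBall hq
    obtain ⟨-, hb0, hbx⟩ := hut hb
    simp only at hpq hle
    have h1 : dist p q < s := hpq.trans_le (min_le_left _ _)
    have h2 : dist p q < b.2 := hpq.trans_le (min_le_right _ _)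
    refine ⟨b, hb, ?_, q, hq, ?_⟩
    · have t1 := dist_triangle x p x₀
      have t2 := dist_triangle p q x₀
      have t3 := dist_triangle q b.1 x₀
      rw [dist_comm x p] at t1
      rw [← mul_div_assoc, div_le_div_iff₀ (by linarith) (by linarith)] at hle
      have h3 : dist x x₀ ≤ 2 * dist b.1 x₀ := by linarith
      have h4 : 0 < dist b.1 x₀ := by linarith
      have h5 : 2 * b.2 * dist x x₀ ≤ 2 * b.2 * (2 * dist b.1 x₀) := by gcongr
      nlinarith
    · have := dist_triangle q p x
      rw [dist_comm q p] at this
      linarith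

/-! ### Geometry and measure of the union -/

namespace IsPieceFamily

variable {k c C₁ C₂ : ℝ} {E : Set X} {𝓖 : Set (Set X)} {x₀ : X} {ι : Type*} {u : Set ι}
  {G P : ι → Set X} {y : ι → X} {r : ι → ℝ}

/-- Near a point off `E` only pieces of size bounded below occur, since each is centred on `E`. By
separation, a small enough ball there meets at most one of them, and that one is closed. -/
theorem isClosed_union (h : IsPieceFamily k c E 𝓖 x₀ u G P y r) (hE : IsClosed E) :
    IsClosed (E ∪ ⋃ a ∈ u, P a) := by
  refine isClosed_of_closure_subset fun z hz => ?_
  by_cases hzE : z ∈ E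
  · exact Or.inl hzE
  obtain ⟨d, hd, hdE⟩ := Metric.isOpen_iff.1 hE.isOpen_compl z hzE
  have large : ∀ a ∈ u, ∀ p ∈ P a, dist p z < d / 2 → d / 4 ≤ r a := by
    intro a ha p hp hpz
    have h1 : dist p (y a) ≤ 2 * r a := (h.piece a ha).subset_closedBall hp
    by_contra! hlt
    refine hdE (?_ : y a ∈ ball z d) (h.piece a ha).mem
    have := dist_triangle (y a) p z
    rw [dist_comm (y a) p] at this
    rw [mem_ball]
    linarith
  have near : ∀ s, 0 < s → s ≤ d / 8 → ∃ a ∈ u, ∃ p ∈ P a, dist p z < s := by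
    intro s hs hsd
    obtain ⟨p, hp, hpz⟩ := Metric.mem_closure_iff.1 hz s hs
    rw [dist_comm] at hpz
    rcases hp with hp | hp
    · exact absurd hp (hdE (by rw [mem_ball]; linarith))
    · obtain ⟨a, ha, hpa⟩ := mem_iUnion₂.1 hp
      exact ⟨a, ha, p, hpa, hpz⟩
  obtain ⟨a, ha, p, hp, hpz⟩ := near (d / 8) (by positivity) le_rfl
  refine Or.inr (mem_iUnion₂.2 ⟨a, ha, ?_⟩)
  rw [← (h.piece a ha).closed.closure_eq, Metric.mem_closure_iff]
  intro s hs
  obtain ⟨b, hb, q, hq, hqz⟩ := near (min s (d / 8)) (by positivity) (min_le_right _ _)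
  have hqs := hqz.trans_le (min_le_left _ _)
  have hqd := hqz.trans_le (min_le_right _ _)
  rcases eq_or_ne a b with rfl | hab
  · exact ⟨q, hq, by rwa [dist_comm]⟩
  · exfalso
    have h1 := h.separated a ha b hb hab p hp q hq
    have h2 := le_min (large a ha p hp (by linarith)) (large b hb q hq (by linarith))
    have h3 := dist_triangle p z q
    rw [dist_comm z q] at h3
    linarith

theorem disjoint (h : IsPieceFamily k c E 𝓖 x₀ u G P y r) {a b : ι} (ha : a ∈ u) (hb : b ∈ u)
    (hab : a ≠ b) : Disjoint (P a) (P b) := by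
  refine Set.disjoint_left.2 fun p hp hq => ?_
  have h1 := h.separated a ha b hb hab p hp p hq
  rw [dist_self] at h1
  exact absurd h1 (not_le.2 (lt_min (h.piece a ha).pos (h.piece b hb).pos))

/-- Pieces that are large compared to a ball do not accumulate in it. -/
theorem measure_large_le (h : IsPieceFamily k c E 𝓖 x₀ u G P y r)
    (h𝓖 : ∀ G ∈ 𝓖, IsADRegular k C₂ G) (z : X) {s : ℝ} (hs : 0 < s) :
    μH[k] (⋃ a ∈ {a ∈ u | 2 * s ≤ r a}, P a ∩ ball z s) ≤
      ENNReal.ofReal (C₂ * (2 * s) ^ k) := by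
  rcases (⋃ a ∈ {a ∈ u | 2 * s ≤ r a}, P a ∩ ball z s).eq_empty_or_nonempty with h0 | ⟨p, hp⟩
  · rw [h0, measure_empty]
    exact zero_le
  · obtain ⟨a, ⟨ha, hra⟩, hpa, hpz⟩ := mem_iUnion₂.1 hp
    refine (measure_mono ?_).trans ((h𝓖 _ (h.mem a ha)).measure_inter_ball_le z hs)
    refine iUnion₂_subset fun b hb q hq => ⟨?_, hq.2⟩
    rcases eq_or_ne a b with rfl | hab
    · exact (h.piece a ha).subset hq.1
    · exfalso
      have h1 := h.separated a ha b hb.1 hab p hpa q hq.1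
      have h2 := le_min hra hb.2
      have h3 := dist_triangle_right p q z
      rw [mem_ball] at hpz
      have h4 : dist q z < s := hq.2
      linarith

/-- Pieces that are small compared to a ball are controlled by their disjoint parts in `E`. -/
theorem measure_small_le (h : IsPieceFamily k c E 𝓖 x₀ u G P y r) (hc : 0 < c) (hC₂ : 0 < C₂)
    (hE : IsADRegular k C₁ E) (h𝓖 : ∀ G ∈ 𝓖, IsADRegular k C₂ G) (z : X) {s : ℝ} (hs : 0 < s) :
    μH[k] (⋃ a ∈ {a ∈ u | r a < 2 * s}, P a ∩ ball z s) ≤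
      ENNReal.ofReal (C₂ * 5 ^ k / c * (C₁ * (18 * s) ^ k)) := by
  set v : Set ι := {a ∈ u | r a < 2 * s ∧ (P a ∩ ball z s).Nonempty} with hv
  have hsub : (⋃ a ∈ {a ∈ u | r a < 2 * s}, P a ∩ ball z s) ⊆ ⋃ a ∈ v, P a := by
    refine iUnion₂_subset fun a ha p hp => mem_iUnion₂.2 ⟨a, ⟨ha.1, ha.2, p, hp⟩, hp.1⟩
  have hPE : ∑' a : v, μH[k] (E ∩ P a) ≤ ENNReal.ofReal (C₁ * (18 * s) ^ k) := by
    calc ∑' a : v, μH[k] (E ∩ P a) ≤ μH[k] (⋃ a : v, E ∩ P a) := by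
          refine tsum_meas_le_meas_iUnion_of_disjoint _
            (fun a => (hE.1.inter (h.piece a a.2.1).closed).measurableSet) fun a b hab => ?_
          exact (h.disjoint a.2.1 b.2.1 (Subtype.coe_injective.ne hab)).mono
            inter_subset_right inter_subset_right
      _ ≤ μH[k] (E ∩ ball z (9 * s)) := by
          refine measure_mono (iUnion_subset fun ⟨a, hau, hra, q, hq, hqz⟩ x hx => ⟨hx.1, ?_⟩)
          have h1 : dist x (y a) ≤ 2 * r a := (h.piece a hau).subset_closedBall hx.2
          have h2 : dist q (y a) ≤ 2 * r a := (h.piece a hau).subset_closedBall hq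
          have h3 := dist_triangle_right x q (y a)
          have h4 := dist_triangle x q z
          rw [mem_ball] at *
          linarith
      _ ≤ _ := by
          refine (hE.measure_inter_ball_le z (by positivity)).trans (le_of_eq ?_)
          ring_nf
  have hP : ∀ a : v, μH[k] (P a) ≤ ENNReal.ofReal (C₂ * 5 ^ k / c) * μH[k] (E ∩ P a) := by
    rintro ⟨a, hau, -, q, hq, -⟩
    have hr := (h.piece a hau).pos
    calc μH[k] (P a) ≤ μH[k] (G a ∩ ball q (5 * r a)) := by
          refine measure_mono fun x hx => ⟨(h.piece a hau).subset hx, ?_⟩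
          have h1 : dist x (y a) ≤ 2 * r a := (h.piece a hau).subset_closedBall hx
          have h2 : dist q (y a) ≤ 2 * r a := (h.piece a hau).subset_closedBall hq
          have h3 := dist_triangle_right x q (y a)
          rw [mem_ball]
          linarith
      _ ≤ ENNReal.ofReal (C₂ * (5 * r a) ^ k) :=
          ((h𝓖 _ (h.mem a hau)).2.2.2 q ((h.piece a hau).subset hq) _ (by positivity)).le
      _ = ENNReal.ofReal (C₂ * 5 ^ k / c) * ENNReal.ofReal (c * r a ^ k) := by
          rw [← ENNReal.ofReal_mul (by positivity), Real.mul_rpow (by norm_num) hr.le]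
          congr 1
          field_simp
      _ ≤ _ := by
          gcongr
          exact (h.piece a hau).mass
  -- Positive masses with finite sum are countably many, which countable subadditivity needs below.
  have hcount : v.Countable := by
    have h1 := Summable.countable_support_ennreal (hPE.trans_lt ENNReal.ofReal_lt_top).ne
    have h2 : Function.support (fun a : v => μH[k] (E ∩ P a)) = univ := by
      refine eq_univ_of_forall fun ⟨a, hau, _⟩ => ?_
      have hr := (h.piece a hau).pos
      exact (lt_of_lt_of_le (ENNReal.ofReal_pos.2 (by positivity)) (h.piece a hau).mass).ne'
    rw [h2] at h1
    exact countable_coe_iff.1 (countable_univ_iff.1 h1)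
  calc _ ≤ μH[k] (⋃ a ∈ v, P a) := measure_mono hsub
    _ ≤ ∑' a : v, μH[k] (P a) := measure_biUnion_le _ hcount _
    _ ≤ ∑' a : v, ENNReal.ofReal (C₂ * 5 ^ k / c) * μH[k] (E ∩ P a) := ENNReal.tsum_le_tsum hP
    _ ≤ ENNReal.ofReal (C₂ * 5 ^ k / c) * ENNReal.ofReal (C₁ * (18 * s) ^ k) := by
        rw [ENNReal.tsum_mul_left]
        gcongr
    _ = _ := by rw [← ENNReal.ofReal_mul (by positivity)]

theorem measure_union_inter_ball_le (h : IsPieceFamily k c E 𝓖 x₀ u G P y r) (hc : 0 < c)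
    (hC₁ : 0 < C₁) (hC₂ : 0 < C₂) (hE : IsADRegular k C₁ E)
    (h𝓖 : ∀ G ∈ 𝓖, IsADRegular k C₂ G) (z : X) {s : ℝ} (hs : 0 < s) :
    μH[k] ((E ∪ ⋃ a ∈ u, P a) ∩ ball z s) ≤ ENNReal.ofReal
      ((C₁ * 2 ^ k + (C₂ * 2 ^ k + C₂ * 5 ^ k / c * (C₁ * 18 ^ k))) * s ^ k) := by
  have hsub : (E ∪ ⋃ a ∈ u, P a) ∩ ball z s ⊆ (E ∩ ball z s) ∪
      ((⋃ a ∈ {a ∈ u | 2 * s ≤ r a}, P a ∩ ball z s) ∪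
        ⋃ a ∈ {a ∈ u | r a < 2 * s}, P a ∩ ball z s) := by
    rintro x ⟨hx | hx, hxz⟩
    · exact Or.inl ⟨hx, hxz⟩
    · obtain ⟨a, ha, hxa⟩ := mem_iUnion₂.1 hx
      rcases le_or_gt (2 * s) (r a) with hr | hr
      · exact Or.inr (Or.inl (mem_iUnion₂.2 ⟨a, ⟨ha, hr⟩, hxa, hxz⟩))
      · exact Or.inr (Or.inr (mem_iUnion₂.2 ⟨a, ⟨ha, hr⟩, hxa, hxz⟩))
  have e : (C₁ * 2 ^ k + (C₂ * 2 ^ k + C₂ * 5 ^ k / c * (C₁ * 18 ^ k))) * s ^ k =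
      C₁ * (2 * s) ^ k + (C₂ * (2 * s) ^ k + C₂ * 5 ^ k / c * (C₁ * (18 * s) ^ k)) := by
    rw [Real.mul_rpow (by norm_num) hs.le, Real.mul_rpow (by norm_num) hs.le]
    ring
  rw [e, ENNReal.ofReal_add (by positivity) (by positivity),
    ENNReal.ofReal_add (by positivity) (by positivity)]
  refine (measure_mono hsub).trans ((measure_union_le _ _).trans
    (add_le_add (hE.measure_inter_ball_le z hs) ((measure_union_le _ _).trans
      (add_le_add (h.measure_large_le h𝓖 z hs) (h.measure_small_le hc hC₂ hE h𝓖 z hs)))))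

theorem ediam_union_le (h : IsPieceFamily k c E 𝓖 x₀ u G P y r) (hx₀ : x₀ ∈ E) :
    ediam (E ∪ ⋃ a ∈ u, P a) ≤ 2 * ediam E := by
  by_cases hfin : ediam E = ⊤
  · simp [hfin]
  have hd : ∀ x ∈ E, ∀ x' ∈ E, dist x x' ≤ diam E := fun x hx x' hx' =>
    dist_le_diam_of_mem' hfin hx hx'
  have near : ∀ z ∈ E ∪ ⋃ a ∈ u, P a, ∃ x ∈ E, dist z x ≤ diam E / 2 := by
    rintro z (hz | hz)
    · exact ⟨z, hz, by rw [dist_self]; exact div_nonneg diam_nonneg zero_le_two⟩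
    · obtain ⟨a, ha, hza⟩ := mem_iUnion₂.1 hz
      refine ⟨y a, (h.piece a ha).mem, ?_⟩
      have h1 : dist z (y a) ≤ 2 * r a := (h.piece a ha).subset_closedBall hza
      have h2 := h.le_dist a ha
      have h3 := hd _ (h.piece a ha).mem _ hx₀
      have h4 := (h.piece a ha).pos
      linarith
  refine ediam_le fun z hz w hw => ?_
  obtain ⟨x, hx, hzx⟩ := near z hz
  obtain ⟨x', hx', hwx⟩ := near w hw
  have h1 := dist_triangle4_right z w x x'
  have h2 := hd x hx x' hx'
  have h3 : ediam E = ENNReal.ofReal (diam E) := (ENNReal.ofReal_toReal hfin).symm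
  rw [h3, edist_dist, ← ENNReal.ofReal_ofNat 2, ← ENNReal.ofReal_mul zero_le_two]
  exact ENNReal.ofReal_le_ofReal (by linarith)

/-- Each ball centred on the union contains a comparable ball of one of the sets `G a`. -/
theorem exists_ball_subset (h : IsPieceFamily k c E 𝓖 x₀ u G P y r)
    (hC₁ : 0 < C₁) (hC₂ : 0 < C₂) (hE : IsADRegular k C₁ E)
    (h𝓖 : ∀ G ∈ 𝓖, IsADRegular k C₂ G) (hx₀ : x₀ ∈ E) {ε η : ℝ} (hε : 0 < ε) (hε8 : ε ≤ 1 / 8)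
    (hεk : ε ^ k ≤ c / (C₂ * 2 ^ k)) (hη : 0 < η) (hη8 : η ≤ 1 / 8)
    (hηk : η ^ k ≤ (1 / 8) ^ k / C₁ ^ 2) {z : X} (hz : z ∈ E ∪ ⋃ a ∈ u, P a) {R : ℝ} (hR : 0 < R)
    (hRE : ENNReal.ofReal (R / 8) < ediam E) :
    ∃ a ∈ u, ∃ w ∈ G a, G a ∩ ball w (ε * η / 40 * R) ⊆ (E ∪ ⋃ a ∈ u, P a) ∩ ball z R ∧
      ENNReal.ofReal (ε * η / 40 * R) < ediam (G a) := by
  have hPu : ∀ a ∈ u, P a ⊆ E ∪ ⋃ a ∈ u, P a := fun a ha =>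
    (subset_biUnion_of_mem ha).trans subset_union_right
  have main : ∀ a ∈ u, ∀ q ∈ P a, η / 40 * R ≤ r a → ball q (η / 40 * R) ⊆ ball z R →
      ∃ a ∈ u, ∃ w ∈ G a, G a ∩ ball w (ε * η / 40 * R) ⊆ (E ∪ ⋃ a ∈ u, P a) ∩ ball z R ∧
        ENNReal.ofReal (ε * η / 40 * R) < ediam (G a) := by
    intro a ha q hq hle hsub
    obtain ⟨w, hw, h1, h2⟩ := (h.piece a ha).exists_ball_subset (h𝓖 _ (h.mem a ha)) hC₂ hε hε8
      hεk hq (s := η / 40 * R) (by positivity) hle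
    have e : ε * η / 40 * R = ε * (η / 40 * R) := by ring
    rw [← e] at h1 h2
    exact ⟨a, ha, w, hw, h1.trans (inter_subset_inter (hPu a ha) hsub), h2⟩
  have hsmall : η / 40 * R ≤ R / 320 := by nlinarith
  by_cases hlarge : ∃ a ∈ u, z ∈ P a ∧ R ≤ 8 * r a
  · obtain ⟨a, ha, hza, hRa⟩ := hlarge
    exact main a ha z hza (by linarith) (ball_subset_ball (by linarith))
  · push Not at hlarge
    obtain ⟨x, hx, hzx⟩ : ∃ x ∈ E, dist z x ≤ R / 4 := by
      rcases hz with hz | hz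
      · exact ⟨z, hz, by rw [dist_self]; positivity⟩
      · obtain ⟨a, ha, hza⟩ := mem_iUnion₂.1 hz
        have h1 : dist z (y a) ≤ 2 * r a := (h.piece a ha).subset_closedBall hza
        exact ⟨y a, (h.piece a ha).mem, by linarith [hlarge a ha hza]⟩
    -- Only pieces small relative to the distance to `x₀` are available, so the centre is first
    -- moved to distance at least `η * R` from `x₀`. Radius `η / 10 * R` is then admissible in
    -- `cover` and gives a piece of size at least `η / 40 * R`.
    obtain ⟨x', hx', hxx, hfar⟩ := hE.exists_far_point hC₁ hη hηk hx hx₀ hR hRE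
    obtain ⟨a, ha, hle, q, hq, hqx⟩ := h.cover x' hx' (η / 10 * R) (by positivity) (by linarith)
    refine main a ha q hq (by linarith) fun p hp => ?_
    rw [mem_ball] at *
    have h1 := dist_triangle4 p q x' x
    have h2 := dist_triangle p x z
    rw [dist_comm x z] at h2
    linarith

end IsPieceFamily

end Pieces

/-! ### Choice of constants and conclusion -/

theorem theorem1 (k C₁ θ₁ C₂ θ₂ : ℝ) (hk : 0 < k) (hC₁ : 1 < C₁) (hθ₁ : 0 < θ₁)
    (hC₂ : 1 < C₂) (hθ₂ : 0 < θ₂) :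
    ∃ C θ : ℝ, 1 < C ∧ 0 < θ ∧
      ∀ (X : Type*) [MetricSpace X] [MeasurableSpace X] [BorelSpace X] (𝓕 : Set (Set X)),
        (∀ G ∈ 𝓕, ∃ C₀ : ℝ, 1 < C₀ ∧ IsADRegular k C₀ G) →
        ∀ E ∈ BP k C₁ θ₁ (BP k C₂ θ₂ 𝓕),
          ∃ F : Set X, E ⊆ F ∧ IsADRegular k C F ∧ F ∈ BP k C θ 𝓕 := by
  have h₁ : 0 < C₁ := by linarith
  have h₂ : 0 < C₂ := by linarith
  set c : ℝ := θ₁ * C₁⁻¹ with hcdef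
  have hc : 0 < c := by positivity
  obtain ⟨ε, hε, hε8, hεk⟩ := exists_pos_rpow_le hk (A := c / (C₂ * 2 ^ k)) (by positivity)
  obtain ⟨η, hη, hη8, hηk⟩ := exists_pos_rpow_le hk (A := (1 / 8) ^ k / C₁ ^ 2) (by positivity)
  set κ : ℝ := ε * η / 40 with hκdef
  have hκ : 0 < κ := by positivity
  set M : ℝ := C₁ * 2 ^ k + (C₂ * 2 ^ k + C₂ * 5 ^ k / c * (C₁ * 18 ^ k)) with hMdef
  have hM : 0 < M := by positivity
  have hlow : 0 < C₂ / κ ^ k := by positivity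
  -- `M` bounds the mass above, and the inverse of `C₂ / κ ^ k` is the lower bound from interior
  -- balls; the extra 1 makes the upper bound strict.
  refine ⟨M + C₂ / κ ^ k + 1, θ₂ * (C₂⁻¹ * κ ^ k) / M, by linarith, by positivity, ?_⟩
  intro X _ _ _ 𝓕 _ E hE
  obtain ⟨hEreg, hEbig⟩ := hE
  obtain ⟨x₀, hx₀⟩ := hEreg.2.1.nonempty
  have h𝓖 : ∀ G ∈ BP k C₂ θ₂ 𝓕, IsADRegular k C₂ G := fun G hG => hG.1
  obtain ⟨u, G, P, h⟩ := exists_isPieceFamily h₁ hθ₁ hEreg (fun G hG => (h𝓖 G hG).1) hEbig hx₀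
  set F : Set X := E ∪ ⋃ a ∈ u, P a with hF
  have hdiam : ediam F ≤ 2 * ediam E := h.ediam_union_le hx₀
  have hupper : ∀ (z : X) {s : ℝ}, 0 < s → μH[k] (F ∩ ball z s) ≤ ENNReal.ofReal (M * s ^ k) :=
    fun z s hs => h.measure_union_inter_ball_le hc h₁ h₂ hEreg h𝓖 z hs
  have hball : ∀ z ∈ F, ∀ R : ℝ, 0 < R → ENNReal.ofReal (R / 8) < ediam E →
      ∃ a ∈ u, ∃ w ∈ G a, G a ∩ ball w (κ * R) ⊆ F ∩ ball z R ∧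
        ENNReal.ofReal (κ * R) < ediam (G a) := fun z hz R hR hRE =>
    h.exists_ball_subset h₁ h₂ hEreg h𝓖 hx₀ hε hε8 hεk hη hη8 hηk hz hR hRE
  have hmass : ∀ R : ℝ, 0 < R → C₂⁻¹ * (κ * R) ^ k = C₂⁻¹ * κ ^ k * R ^ k := fun R hR => by
    rw [Real.mul_rpow hκ.le hR.le, mul_assoc]
  have hFreg : IsADRegular k (M + C₂ / κ ^ k + 1) F := by
    refine ⟨h.isClosed_union hEreg.1, hEreg.2.1.mono subset_union_left,
      fun z hz s hs hsF => ?_, fun z _ s hs => (hupper z hs).trans_lt ?_⟩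
    · have hsE : ENNReal.ofReal (s / 8) < ediam E := by
        by_contra! hle
        have h1 : ediam F ≤ ENNReal.ofReal (2 * (s / 8)) := by
          rw [ENNReal.ofReal_mul zero_le_two, ENNReal.ofReal_ofNat]
          exact hdiam.trans (by gcongr)
        have h2 := (ENNReal.ofReal_lt_ofReal_iff'.1 (hsF.trans_le h1)).1
        linarith
      obtain ⟨a, ha, w, hw, hsub, hwd⟩ := hball z hz s hs hsE
      refine lt_of_le_of_lt ?_ (((h𝓖 _ (h.mem a ha)).2.2.1 w hw (κ * s) (by positivity)
        hwd).trans_le (measure_mono hsub))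
      refine ENNReal.ofReal_le_ofReal ?_
      rw [hmass s hs]
      have h1 : (M + C₂ / κ ^ k + 1)⁻¹ ≤ (C₂ / κ ^ k)⁻¹ := by
        gcongr
        linarith
      have h2 : (C₂ / κ ^ k)⁻¹ = C₂⁻¹ * κ ^ k := by
        rw [inv_div, div_eq_inv_mul]
      rw [h2] at h1
      gcongr
    · have : 0 < s ^ k := by positivity
      rw [ENNReal.ofReal_lt_ofReal_iff (by positivity)]
      gcongr
      linarith
  refine ⟨F, subset_union_left, hFreg, hFreg, ?_⟩
  have hbig : ∀ z ∈ F, ∀ R : ℝ, 0 < R → ENNReal.ofReal (R / 8) < ediam E → ∃ G' ∈ 𝓕,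
      ENNReal.ofReal (θ₂ * (C₂⁻¹ * κ ^ k) / M) * μH[k] (ball z R ∩ F) ≤
        μH[k] (ball z R ∩ F ∩ G') := by
    intro z hz R hR hRE
    obtain ⟨a, ha, w, hw, hsub, hwd⟩ := hball z hz R hR hRE
    obtain ⟨G', hG', hbig⟩ := (h.mem a ha).2 w hw (κ * R) (by positivity)
    refine ⟨G', hG', ?_⟩
    calc ENNReal.ofReal (θ₂ * (C₂⁻¹ * κ ^ k) / M) * μH[k] (ball z R ∩ F)
        ≤ ENNReal.ofReal (θ₂ * (C₂⁻¹ * κ ^ k) / M) * ENNReal.ofReal (M * R ^ k) := by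
          rw [inter_comm]
          gcongr
          exact hupper z hR
      _ = ENNReal.ofReal θ₂ * ENNReal.ofReal (C₂⁻¹ * (κ * R) ^ k) := by
          rw [← ENNReal.ofReal_mul (by positivity), ← ENNReal.ofReal_mul hθ₂.le, hmass R hR]
          congr 1
          field_simp
      _ ≤ ENNReal.ofReal θ₂ * μH[k] (ball w (κ * R) ∩ G a) := by
          rw [inter_comm]
          gcongr
          exact ((h𝓖 _ (h.mem a ha)).2.2.1 w hw (κ * R) (by positivity) hwd).le
      _ ≤ μH[k] (ball w (κ * R) ∩ G a ∩ G') := hbig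
      _ ≤ μH[k] (ball z R ∩ F ∩ G') := by
          refine measure_mono (inter_subset_inter_left _ ?_)
          rw [inter_comm, inter_comm (ball z R)]
          exact hsub
  intro z hz R hR
  by_cases hRE : ENNReal.ofReal (R / 8) < ediam E
  · exact hbig z hz R hR hRE
  · rw [not_lt] at hRE
    have hfin : ediam E ≠ ⊤ := (hRE.trans_lt ENNReal.ofReal_lt_top).ne
    have hD : ediam E = ENNReal.ofReal (diam E) := (ENNReal.ofReal_toReal hfin).symm
    have hD0 : 0 < diam E := ENNReal.toReal_pos (ediam_pos_iff.2 hEreg.2.1).ne' hfin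
    have hDR : diam E ≤ R / 8 := by
      rwa [hD, ENNReal.ofReal_le_ofReal_iff (by positivity)] at hRE
    -- This radius already captures all of `F`, whose diameter is at most `2 * diam E`, so larger
    -- balls give nothing new.
    obtain ⟨G', hG', hb⟩ := hbig z hz (4 * diam E) (by positivity) (by
      rw [hD, ENNReal.ofReal_lt_ofReal_iff hD0]
      linarith)
    have hsub : F ⊆ ball z (4 * diam E) := fun x hx => by
      have h1 := (edist_le_ediam_of_mem hx hz).trans hdiam
      rw [hD, edist_dist, ← ENNReal.ofReal_ofNat 2, ← ENNReal.ofReal_mul zero_le_two,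
        ENNReal.ofReal_le_ofReal_iff (by positivity)] at h1
      rw [mem_ball]
      linarith
    refine ⟨G', hG', ?_⟩
    rw [inter_eq_self_of_subset_right hsub] at hb
    rwa [inter_eq_self_of_subset_right (hsub.trans (ball_subset_ball (by linarith)))]
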